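/- Let $q,r$ be meromorphic functions on $\mathbb{C}$ and let $T[y]=y''+q(z)y'+r(z)y$. A \emph{polynomial eigenfunction} of $T$ is a nonzero polynomial $y\in\mathbb{C}[z]$ such that $T[y]=\lambda y$ for some $\lambda\in\mathbb{R}$. Suppose that $T$ is \emph{solvable by polynomials}, i.e. for all but finitely many $n\in\mathbb{N}$ there is a polynomial eigenfunction of $T$ of degree $n$, and that $T$ is \emph{primitive}, i.e. no polynomial $\sigma$ of degree $\geq 1$ divides every polynomial eigenfunction of $T$. Then for every $\lambda\in\mathbb{C}$ the general solution of the equation $T[y]=\lambda y$ is an entire function: there are two linearly independent entire solutions $\varphi_1,\varphi_2$, and every holomorphic solution $f$ on any domain (nonempty connected open set) $U\subseteq\mathbb{C}$ is the restriction to $U$ of $c_1\varphi_1+c_2\varphi_2$ for some $c_1,c_2\in\mathbb{C}$. In particular, $T$ has \emph{trivial monodromy}: for every $\zeta\in\mathbb{C}$ and every $\lambda\in\mathbb{C}$ the equation $T[\varphi]=\lambda\varphi$ has two linearly independent solutions that are meromorphic at $\zeta$. (All differential equations are identities of meromorphic functions, i.e. they are required to hold away from isolated points.) -/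

import Mathlib

open Filter Topology

/-- The second-order differential expression `T[f] = f'' + q f' + r f`. -/
noncomputable def diffOp (q r : ℂ → ℂ) (f : ℂ → ℂ) : ℂ → ℂ :=
  fun z => deriv (deriv f) z + q z * deriv f z + r z * f z

/-- `f` satisfies `T[f] = ev • f` near `z`. The point `z` itself is left out, because `q`, `r` or `f`
may have a pole there (and Lean's value of a meromorphic function at a pole has no meaning). -/
def SolvesNear (q r : ℂ → ℂ) (ev : ℂ) (f : ℂ → ℂ) (z : ℂ) : Prop :=
  ∀ᶠ w in 𝓝[≠] z, diffOp q r f w = ev * f w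

/-- `f` satisfies `T[f] = ev • f` on the open set `U`, as an identity of meromorphic functions,
that is, off a set of isolated points of `U` (closed and discrete in `U`). -/
def SolvesOn (q r : ℂ → ℂ) (ev : ℂ) (f : ℂ → ℂ) (U : Set ℂ) : Prop :=
  ∀ z ∈ U, SolvesNear q r ev f z

/-- A polynomial eigenfunction of `T`: a nonzero polynomial `y` with `T[y] = ev • y`, `ev` real. -/
def IsPolyEigenfunction (q r : ℂ → ℂ) (y : Polynomial ℂ) : Prop :=
  y ≠ 0 ∧ ∃ ev : ℝ, SolvesOn q r (ev : ℂ) (fun z => y.eval z) Set.univ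

/-- `T` is solvable by polynomials: for all but finitely many `n` there is a polynomial
eigenfunction of degree `n`. -/
def SolvableByPolynomials (q r : ℂ → ℂ) : Prop :=
  {n : ℕ | ¬ ∃ y : Polynomial ℂ, IsPolyEigenfunction q r y ∧ y.natDegree = n}.Finite

/-- `T` is primitive: no polynomial of degree at least one divides every polynomial
eigenfunction. -/
def IsPrimitiveOp (q r : ℂ → ℂ) : Prop :=
  ¬ ∃ σ : Polynomial ℂ, 1 ≤ σ.natDegree ∧
    ∀ y : Polynomial ℂ, IsPolyEigenfunction q r y → σ ∣ y

/-- The general solution of `T[y] = ev • y` is entire: there are two linearly independent entire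
solutions `φ₁`, `φ₂`, and every holomorphic solution on any domain `U` of the plane is the
restriction to `U` of some `c₁ φ₁ + c₂ φ₂`. -/
def GeneralSolutionEntire (q r : ℂ → ℂ) (ev : ℂ) : Prop :=
  ∃ φ₁ φ₂ : ℂ → ℂ,
    Differentiable ℂ φ₁ ∧ Differentiable ℂ φ₂ ∧
    SolvesOn q r ev φ₁ Set.univ ∧ SolvesOn q r ev φ₂ Set.univ ∧
    LinearIndependent ℂ ![φ₁, φ₂] ∧
    ∀ (U : Set ℂ) (f : ℂ → ℂ), IsOpen U → IsConnected U →
      DifferentiableOn ℂ f U → SolvesOn q r ev f U →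
      ∃ c₁ c₂ : ℂ, ∀ z ∈ U, f z = c₁ * φ₁ z + c₂ * φ₂ z

/-- `T` has trivial monodromy at `ζ`: for every `ev` there are two solutions of `T[φ] = ev • φ`,
meromorphic at `ζ`, that are linearly independent (as germs at `ζ`). -/
def TrivialMonodromyAt (q r : ℂ → ℂ) (ζ : ℂ) : Prop :=
  ∀ ev : ℂ, ∃ φ₁ φ₂ : ℂ → ℂ,
    MeromorphicAt φ₁ ζ ∧ MeromorphicAt φ₂ ζ ∧
    SolvesNear q r ev φ₁ ζ ∧ SolvesNear q r ev φ₂ ζ ∧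
    ∀ c₁ c₂ : ℂ, (∀ᶠ w in 𝓝[≠] ζ, c₁ * φ₁ w + c₂ * φ₂ w = 0) → c₁ = 0 ∧ c₂ = 0

/-- `T` has trivial monodromy. -/
def TrivialMonodromy (q r : ℂ → ℂ) : Prop :=
  ∀ ζ : ℂ, TrivialMonodromyAt q r ζ

/-!
Two eigenpolynomials of different degrees have a nonzero Wronskian `w`, and Cramer's rule gives
`q = Q / w` and `r = R / w` with polynomials `Q`, `R` (`exists_rational_coefficients`). All the
differential equations can therefore be written as `w f'' + Q f' + R f = ev w f`.

The span `U` of the eigenpolynomials is invariant under `T` and has finite codimension in `ℂ[X]`,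
so that all but finitely many integers occur as orders of vanishing at `ζ` of elements of `U`.
Let `d ≥ 2` be the amount by which `T` lowers a generic order. Since `T` maps `U` into polynomials, descending from
large orders must reach a root of the indicial polynomial in every residue class modulo `d`. This
indicial polynomial has degree at most two, whence `d = 2`, and by primitivity one of the roots
is `0`; the other is an odd number `n + 1`. The orders occurring in `U` are stable under adding `2`
and avoid `n - 1`, so the remainder of an approximate solution in `U` of `T f = ev f` can always be
corrected to the next order without meeting the resonance at `n + 1`. Hence there is no logarithmic
obstruction, for any `ev` (`exists_local_normal_form`).

To pass to global solutions, let `H` be the product of the `(X - ζ) ^ n` over the singular points,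
and let `u` be a polynomial that agrees with `f' / f` to order `n` at each of them, where `f` is
the local approximate solution. The substitution `y' = u y + H v` then produces a first-order
linear system with polynomial coefficients (`exists_desingularization`), and such a system has
entire solutions, given by power series with infinite radius of convergence
(`exists_entire_solution_system`). Neither convergence at a singular point nor analytic continuation
is needed. A holomorphic solution on a domain is determined by its initial values at an ordinary point
(`SolvesClearedNear.eventually_eq_zero`), which gives the spanning property.
-/

open Finset.HasAntidiagonal (antidiagonal)

/-! ### Linear systems with entire coefficients -/

/-- The Taylor coefficients at `0` of the fundamental solution of `Y' = A Y`, `Y 0 = 1`, where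
`A z = ∑ z ^ j • a j`. -/
noncomputable def fundCoeff {𝔸 : Type*} [NormedRing 𝔸] [NormedAlgebra ℂ 𝔸] (a : ℕ → 𝔸) : ℕ → 𝔸
  | 0 => 1
  | k + 1 => ((k : ℂ) + 1)⁻¹ • ∑ j : Fin (k + 1), a (k - j) * fundCoeff a j

section
variable {𝔸 : Type*} [NormedRing 𝔸] [NormedAlgebra ℂ 𝔸]

theorem fundCoeff_succ (a : ℕ → 𝔸) (k : ℕ) :
    ((k : ℂ) + 1) • fundCoeff a (k + 1) =
      ∑ p ∈ antidiagonal k, a p.1 * fundCoeff a p.2 := by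
  have hk : (k : ℂ) + 1 ≠ 0 := Nat.cast_add_one_ne_zero k
  rw [fundCoeff, smul_inv_smul₀ hk, ← Finset.Nat.sum_antidiagonal_swap,
    Finset.Nat.sum_antidiagonal_eq_sum_range_succ_mk]
  exact (Finset.sum_range fun j => a (k - j) * fundCoeff a j).symm

/-- The recursion divides by `k + 1`, which eventually exceeds any multiple of `∑ ‖a j‖ * R ^ j`;
hence the coefficients decay faster than any geometric sequence. -/
theorem exists_norm_fundCoeff_le (a : ℕ → 𝔸) {R : ℝ} (hR : 0 < R)
    (ha : Summable fun j => ‖a j‖ * R ^ j) :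
    ∃ C : ℝ, ∀ k, ‖fundCoeff a k‖ * R ^ k ≤ C := by
  set S := ∑' j, ‖a j‖ * R ^ j
  obtain ⟨K, hK⟩ := exists_nat_ge (R * S)
  have hS : 0 ≤ S := tsum_nonneg fun j => by positivity
  set C := ∑ k ∈ Finset.range (K + 1), ‖fundCoeff a k‖ * R ^ k
  have hC : 0 ≤ C := Finset.sum_nonneg fun j _ => by positivity
  refine ⟨C, fun k => ?_⟩
  induction k using Nat.strong_induction_on with
  | _ k ih =>
    by_cases hkK : k < K + 1
    · exact Finset.single_le_sum (f := fun k => ‖fundCoeff a k‖ * R ^ k)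
        (fun j _ => by positivity) (Finset.mem_range.2 hkK)
    obtain ⟨m, rfl⟩ : ∃ m, k = m + 1 := ⟨k - 1, by omega⟩
    have hm : (K : ℝ) ≤ (m : ℝ) + 1 := by exact_mod_cast (by omega : K ≤ m + 1)
    have hm0 : (0 : ℝ) < (m : ℝ) + 1 := by positivity
    have h1 : ((m : ℝ) + 1) * ‖fundCoeff a (m + 1)‖ ≤
        ∑ p ∈ antidiagonal m, ‖a p.1‖ * ‖fundCoeff a p.2‖ := by
      have h := congrArg norm (fundCoeff_succ a m)
      rw [norm_smul] at h
      have hn : ‖(m : ℂ) + 1‖ = (m : ℝ) + 1 := by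
        rw [← Nat.cast_add_one, Complex.norm_natCast, Nat.cast_add_one]
      rw [← hn, h]
      exact (norm_sum_le _ _).trans (Finset.sum_le_sum fun p _ => norm_mul_le _ _)
    have h2 : (∑ p ∈ antidiagonal m, ‖a p.1‖ * ‖fundCoeff a p.2‖) * R ^ m ≤ S * C := by
      rw [Finset.sum_mul]
      calc ∑ p ∈ antidiagonal m, ‖a p.1‖ * ‖fundCoeff a p.2‖ * R ^ m
          ≤ ∑ p ∈ antidiagonal m, ‖a p.1‖ * R ^ p.1 * C := by
            refine Finset.sum_le_sum fun p hp => ?_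
            have hp' := Finset.HasAntidiagonal.mem_antidiagonal.1 hp
            have : ‖a p.1‖ * ‖fundCoeff a p.2‖ * R ^ m =
                ‖a p.1‖ * R ^ p.1 * (‖fundCoeff a p.2‖ * R ^ p.2) := by
              rw [← hp', pow_add]; ring
            rw [this]
            exact mul_le_mul_of_nonneg_left (ih p.2 (by omega)) (by positivity)
        _ = (∑ j ∈ Finset.range (m + 1), ‖a j‖ * R ^ j) * C := by
            rw [← Finset.sum_mul, Finset.Nat.sum_antidiagonal_eq_sum_range_succ_mk]
        _ ≤ S * C := mul_le_mul_of_nonneg_right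
            (ha.sum_le_tsum _ fun j _ => by positivity) hC
    have h3 : ((m : ℝ) + 1) * (‖fundCoeff a (m + 1)‖ * R ^ (m + 1)) ≤ ((m : ℝ) + 1) * C := by
      calc ((m : ℝ) + 1) * (‖fundCoeff a (m + 1)‖ * R ^ (m + 1))
          = (((m : ℝ) + 1) * ‖fundCoeff a (m + 1)‖) * R ^ m * R := by ring
        _ ≤ (∑ p ∈ antidiagonal m, ‖a p.1‖ * ‖fundCoeff a p.2‖) * R ^ m * R := by gcongr
        _ ≤ S * C * R := by gcongr
        _ = (R * S) * C := by ring
        _ ≤ ((m : ℝ) + 1) * C := by gcongr; exact hK.trans hm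
    exact le_of_mul_le_mul_left h3 hm0

theorem exists_entire_fundamental_solution [CompleteSpace 𝔸] (a : ℕ → 𝔸)
    (ha : ∀ R : ℝ, 0 < R → Summable fun j => ‖a j‖ * R ^ j) :
    ∃ Y : ℂ → 𝔸, Y 0 = 1 ∧ ∀ z, HasDerivAt Y ((∑' j, z ^ j • a j) * Y z) z := by
  refine ⟨fun z => ∑' k, z ^ k • fundCoeff a k, ?_, fun z => ?_⟩
  · beta_reduce
    rw [tsum_eq_single 0 fun k hk => by simp [hk]]
    simp [fundCoeff]
  set ρ : ℝ := ‖z‖ + 1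
  have hρ : 0 < ρ := by positivity
  obtain ⟨C, hC⟩ := exists_norm_fundCoeff_le a (R := 2 * ρ) (by positivity) (ha _ (by positivity))
  have hb : ∀ k, ‖fundCoeff a k‖ * ρ ^ k ≤ C * (1 / 2) ^ k := fun k => by
    have h := mul_le_mul_of_nonneg_right (hC k) (by positivity : (0 : ℝ) ≤ (1 / 2) ^ k)
    refine le_trans (le_of_eq ?_) h
    rw [mul_assoc, ← mul_pow]
    congr 2
    ring
  have hmem : z ∈ Metric.ball (0 : ℂ) ρ := by simp [ρ]
  have hsum : ∀ x ∈ Metric.ball (0 : ℂ) ρ, Summable fun k => ‖x ^ k • fundCoeff a k‖ := by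
    intro x hx
    have hx' : ‖x‖ ≤ ρ := by simpa using (Metric.mem_ball.1 hx).le
    refine Summable.of_nonneg_of_le (fun _ => norm_nonneg _) (fun k => ?_)
      ((summable_geometric_of_lt_one (r := 1 / 2) (by norm_num) (by norm_num)).mul_left C)
    rw [norm_smul, norm_pow, mul_comm]
    exact le_trans (by gcongr) (hb k)
  have hderiv : HasDerivAt (fun x : ℂ => ∑' k, x ^ k • fundCoeff a k)
      (∑' k : ℕ, ((k : ℂ) * z ^ (k - 1)) • fundCoeff a k) z := by
    refine hasDerivAt_tsum_of_isPreconnected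
      (g := fun k (x : ℂ) => x ^ k • fundCoeff a k)
      (g' := fun k (x : ℂ) => ((k : ℂ) * x ^ (k - 1)) • fundCoeff a k)
      (u := fun k : ℕ => C / ρ * ((k : ℝ) ^ 1 * (1 / 2 : ℝ) ^ k))
      ?_ Metric.isOpen_ball (convex_ball (0 : ℂ) ρ).isPreconnected ?_ ?_ hmem
      (hsum z hmem).of_norm hmem
    · exact (summable_pow_mul_geometric_of_norm_lt_one 1
        (by norm_num : ‖(1 / 2 : ℝ)‖ < 1)).mul_left _
    · intro k x _
      exact (hasDerivAt_pow k x).smul_const _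
    · intro k x hx
      have hx' : ‖x‖ ≤ ρ := by simpa using (Metric.mem_ball.1 hx).le
      rcases k with _ | k
      · simp
      rw [norm_smul, norm_mul, norm_pow, Complex.norm_natCast, Nat.add_sub_cancel]
      have h1 := hb (k + 1)
      have h2 : ‖fundCoeff a (k + 1)‖ * ρ ^ k ≤ C / ρ * (1 / 2) ^ (k + 1) := by
        rw [div_mul_eq_mul_div, le_div_iff₀ hρ]
        calc _ = ‖fundCoeff a (k + 1)‖ * ρ ^ (k + 1) := by ring
          _ ≤ _ := h1
      calc ((k + 1 : ℕ) : ℝ) * ‖x‖ ^ k * ‖fundCoeff a (k + 1)‖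
          ≤ ((k + 1 : ℕ) : ℝ) * ρ ^ k * ‖fundCoeff a (k + 1)‖ := by gcongr
        _ = ((k + 1 : ℕ) : ℝ) * (‖fundCoeff a (k + 1)‖ * ρ ^ k) := by ring
        _ ≤ ((k + 1 : ℕ) : ℝ) * (C / ρ * (1 / 2) ^ (k + 1)) := by gcongr
        _ = _ := by ring
  have hA : Summable fun j => ‖z ^ j • a j‖ := by
    refine Summable.of_nonneg_of_le (fun _ => norm_nonneg _) (fun j => ?_) (ha ρ hρ)
    rw [norm_smul, norm_pow, mul_comm]
    have : ‖z‖ ≤ ρ := by simp [ρ]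
    gcongr
  convert hderiv using 1
  rw [tsum_mul_tsum_eq_tsum_sum_antidiagonal_of_summable_norm hA (hsum z hmem)]
  have hshift : ∀ k, ∑ p ∈ antidiagonal k, z ^ p.1 • a p.1 * z ^ p.2 • fundCoeff a p.2 =
      (((k + 1 : ℕ) : ℂ) * z ^ (k + 1 - 1)) • fundCoeff a (k + 1) := fun k => by
    rw [mul_comm, mul_smul, Nat.cast_add_one, fundCoeff_succ, Finset.smul_sum]
    refine Finset.sum_congr rfl fun p hp => ?_
    rw [smul_mul_smul_comm, ← pow_add, Finset.HasAntidiagonal.mem_antidiagonal.1 hp,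
      Nat.add_sub_cancel]
  have hs : Summable fun k : ℕ => ((k : ℂ) * z ^ (k - 1)) • fundCoeff a k := by
    rw [← summable_nat_add_iff 1]
    refine Summable.congr ?_ fun k => hshift k
    exact (summable_norm_sum_mul_antidiagonal_of_summable_norm hA (hsum z hmem)).of_norm
  rw [hs.tsum_eq_zero_add]
  simp only [hshift]
  simp

end

open Polynomial in
/-- A planar linear system with polynomial coefficients has an entire solution with any prescribed
value at `0`. -/
theorem exists_entire_solution_system (a b c d : ℂ[X]) (y₀ v₀ : ℂ) :
    ∃ y v : ℂ → ℂ, y 0 = y₀ ∧ v 0 = v₀ ∧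
      (∀ z, HasDerivAt y (a.eval z * y z + b.eval z * v z) z) ∧
      ∀ z, HasDerivAt v (c.eval z * y z + d.eval z * v z) z := by
  let M : ℕ → (ℂ × ℂ →L[ℂ] ℂ × ℂ) := fun j =>
    (a.coeff j • ContinuousLinearMap.fst ℂ ℂ ℂ + b.coeff j • ContinuousLinearMap.snd ℂ ℂ ℂ).prod
      (c.coeff j • ContinuousLinearMap.fst ℂ ℂ ℂ + d.coeff j • ContinuousLinearMap.snd ℂ ℂ ℂ)
  set N := a.natDegree + b.natDegree + c.natDegree + d.natDegree + 1
  have hM : ∀ j ∉ Finset.range N, M j = 0 := fun j hj => by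
    have hj' : N ≤ j := by simpa using hj
    ext <;> simp [M, coeff_eq_zero_of_natDegree_lt (show a.natDegree < j by omega),
      coeff_eq_zero_of_natDegree_lt (show b.natDegree < j by omega),
      coeff_eq_zero_of_natDegree_lt (show c.natDegree < j by omega),
      coeff_eq_zero_of_natDegree_lt (show d.natDegree < j by omega)]
  obtain ⟨Y, hY0, hY⟩ := exists_entire_fundamental_solution M fun R _ =>
    summable_of_ne_finset_zero (s := Finset.range N) fun j hj => by simp [hM j hj]
  have key : ∀ z, HasDerivAt (fun x => Y x (y₀, v₀))
      (((∑ j ∈ Finset.range N, z ^ j • M j) * Y z) (y₀, v₀)) z := fun z => by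
    have h := hY z
    rw [tsum_eq_sum (s := Finset.range N) fun j hj => by simp [hM j hj]] at h
    exact (ContinuousLinearMap.apply ℂ (ℂ × ℂ) (y₀, v₀)).hasFDerivAt.comp_hasDerivAt z h
  have hev : ∀ (p : ℂ[X]), p.natDegree < N → ∀ z,
      p.eval z = ∑ j ∈ Finset.range N, p.coeff j * z ^ j := fun p hp z =>
    eval_eq_sum_range' hp z
  refine ⟨fun z => (Y z (y₀, v₀)).1, fun z => (Y z (y₀, v₀)).2, by simp [hY0], by simp [hY0],
    fun z => ?_, fun z => ?_⟩
  · refine ((ContinuousLinearMap.fst ℂ ℂ ℂ).hasFDerivAt.comp_hasDerivAt z (key z)).congr_deriv ?_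
    rw [hev a (by omega), hev b (by omega)]
    simp [M, Finset.sum_mul, mul_add, Finset.sum_add_distrib]
    congr 1 <;> exact Finset.sum_congr rfl fun j _ => by ring
  · refine ((ContinuousLinearMap.snd ℂ ℂ ℂ).hasFDerivAt.comp_hasDerivAt z (key z)).congr_deriv ?_
    rw [hev c (by omega), hev d (by omega)]
    simp [M, Finset.sum_mul, mul_add, Finset.sum_add_distrib]
    congr 1 <;> exact Finset.sum_congr rfl fun j _ => by ring

/-! ### Orders of vanishing on an invariant space of polynomials -/

section LocalAnalysis

open Polynomial

/-- The orders of vanishing at `ζ` of the nonzero elements of `U`. -/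
def vanishingOrders (U : Submodule ℂ ℂ[X]) (ζ : ℂ) : Set ℕ :=
  {k | ∃ v : ℂ[X], (X - C ζ) ^ k * v ∈ U ∧ v.eval ζ ≠ 0}

/-- The powers of `X - C ζ` whose exponents are missing from the orders of vanishing are linearly
independent modulo `U`. -/
theorem exists_forall_ge_mem_vanishingOrders (U : Submodule ℂ ℂ[X])
    [Module.Finite ℂ (ℂ[X] ⧸ U)] (ζ : ℂ) : ∃ N, ∀ k ≥ N, k ∈ vanishingOrders U ζ := by
  set I := vanishingOrders U ζ
  have hli : LinearIndependent ℂ fun k : (Iᶜ : Set ℕ) => U.mkQ ((X - C ζ) ^ (k : ℕ)) := by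
    rw [linearIndependent_iff']
    intro s g hg
    by_contra! hne
    have hS : (s.filter fun i => g i ≠ 0).Nonempty := by
      obtain ⟨i, hi, hgi⟩ := hne
      exact ⟨i, Finset.mem_filter.2 ⟨hi, hgi⟩⟩
    -- The lowest exponent with a nonzero coefficient is an order of vanishing.
    obtain ⟨k, hk, hmin⟩ := Finset.exists_min_image _ (fun i : (Iᶜ : Set ℕ) => (i : ℕ)) hS
    obtain ⟨hks, hgk⟩ := Finset.mem_filter.1 hk
    refine k.2 ⟨∑ i ∈ s, C (g i) * (X - C ζ) ^ ((i : ℕ) - k), ?_, ?_⟩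
    · have h1 : ∑ i ∈ s, g i • (X - C ζ) ^ (i : ℕ) ∈ U := by
        rw [← Submodule.Quotient.mk_eq_zero, ← Submodule.mkQ_apply, map_sum]
        simpa using hg
      convert h1 using 1
      rw [Finset.mul_sum]
      refine Finset.sum_congr rfl fun i hi => ?_
      by_cases h0 : g i = 0
      · simp [h0]
      have hle : (k : ℕ) ≤ i := hmin i (Finset.mem_filter.2 ⟨hi, h0⟩)
      rw [smul_eq_C_mul, mul_left_comm, ← pow_add, Nat.add_sub_cancel' hle]
    · rw [eval_finsetSum, Finset.sum_eq_single k]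
      · simpa using hgk
      · intro i hi hik
        by_cases h0 : g i = 0
        · simp [h0]
        have hle : (k : ℕ) ≤ i := hmin i (Finset.mem_filter.2 ⟨hi, h0⟩)
        have hlt : (k : ℕ) ≠ i := fun h => hik (Subtype.ext h.symm)
        simp [Nat.sub_ne_zero_of_lt (lt_of_le_of_ne hle hlt)]
      · exact fun h => (h hks).elim
  have : Finite (Iᶜ : Set ℕ) := hli.finite
  have hfin : (Iᶜ : Set ℕ).Finite := Set.toFinite _
  obtain ⟨N, hN⟩ := hfin.bddAbove
  refine ⟨N + 1, fun k hk => ?_⟩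
  by_contra h
  have : k ≤ N := hN h
  omega

theorem X_sub_C_mul_derivative_pow_mul (ζ : ℂ) (k : ℕ) (v : ℂ[X]) :
    (X - C ζ) * derivative ((X - C ζ) ^ k * v) =
      (X - C ζ) ^ k * (C (k : ℂ) * v + (X - C ζ) * derivative v) := by
  rcases k with _ | k
  · simp
  · simp only [derivative_mul, derivative_X_sub_C_pow, Nat.add_sub_cancel, map_natCast]
    ring

theorem X_sub_C_sq_mul_derivative_derivative_pow_mul (ζ : ℂ) (k : ℕ) (v : ℂ[X]) :
    (X - C ζ) ^ 2 * derivative (derivative ((X - C ζ) ^ k * v)) =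
      (X - C ζ) ^ k * (C ((k : ℂ) * (k - 1)) * v + 2 * C (k : ℂ) * (X - C ζ) * derivative v +
        (X - C ζ) ^ 2 * derivative (derivative v)) := by
  set t := X - C ζ with ht
  have h1 := X_sub_C_mul_derivative_pow_mul ζ k v
  have h2 := X_sub_C_mul_derivative_pow_mul ζ k (C (k : ℂ) * v + t * derivative v)
  rw [← ht] at h1 h2
  have h3 := congrArg derivative h1
  have ht' : derivative t = 1 := by simp [ht]
  simp only [derivative_mul, ht', derivative_add, derivative_C] at h2 h3 ⊢
  simp only [derivative_mul] at h1
  simp only [map_mul, map_sub, map_one]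
  linear_combination t * h3 - h1 + h2

/-- Multiplying a second-order operator by `(X - C ζ) ^ 2` and removing the common power of
`X - C ζ` writes it as `A θ (θ - 1) + B θ + D`, where `θ = (X - C ζ) d/dX` and
`A`, `B`, `D` do not all vanish at `ζ`. -/
theorem exists_euler_form (w Q R : ℂ[X]) (hw : w ≠ 0) (ζ : ℂ) :
    ∃ (s : ℕ) (A B D : ℂ[X]), w = (X - C ζ) ^ s * A ∧ (X - C ζ) * Q = (X - C ζ) ^ s * B ∧
      (X - C ζ) ^ 2 * R = (X - C ζ) ^ s * D ∧
      ¬ (A.eval ζ = 0 ∧ B.eval ζ = 0 ∧ D.eval ζ = 0) := by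
  classical
  set t := X - C ζ with ht
  let P : ℕ → Prop := fun s => t ^ s ∣ w ∧ t ^ s ∣ t * Q ∧ t ^ s ∣ t ^ 2 * R
  set s := Nat.findGreatest P w.natDegree
  have hP : P s := Nat.findGreatest_spec (m := 0) (Nat.zero_le _) (by simp [P])
  obtain ⟨⟨A, hA⟩, ⟨B, hB⟩, ⟨D, hD⟩⟩ := hP
  refine ⟨s, A, B, D, hA, hB, hD, fun ⟨h1, h2, h3⟩ => ?_⟩
  have hP' : P (s + 1) := by
    refine ⟨?_, ?_, ?_⟩
    · rw [hA, pow_succ]; exact mul_dvd_mul_left _ (dvd_iff_isRoot.2 h1)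
    · rw [hB, pow_succ]; exact mul_dvd_mul_left _ (dvd_iff_isRoot.2 h2)
    · rw [hD, pow_succ]; exact mul_dvd_mul_left _ (dvd_iff_isRoot.2 h3)
  have hle : s + 1 ≤ w.natDegree := by
    have h := natDegree_le_of_dvd hP'.1 hw
    rwa [ht, natDegree_pow, natDegree_X_sub_C, mul_one] at h
  exact absurd (Nat.le_findGreatest hle hP') (by omega)

/-- The effect on orders of vanishing of the operator `y ↦ τ` in the Euler form
`(X - C ζ) ^ 2 * A * τ = A θ (θ - 1) y + B θ y + D y`, where `A = (X - C ζ) ^ a * A'` has order `a`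
at `ζ`: an order `k` which is not a root of the indicial polynomial drops by exactly `a + 2`. -/
theorem order_drop {ζ : ℂ} {s a k : ℕ} {w Q R A' B D v τ : ℂ[X]}
    (hw : w = (X - C ζ) ^ s * ((X - C ζ) ^ a * A')) (hQ : (X - C ζ) * Q = (X - C ζ) ^ s * B)
    (hR : (X - C ζ) ^ 2 * R = (X - C ζ) ^ s * D) (hA' : A'.eval ζ ≠ 0) (hv : v.eval ζ ≠ 0)
    (hk : ((X - C ζ) ^ a * A').eval ζ * ((k : ℂ) * (k - 1)) + B.eval ζ * k + D.eval ζ ≠ 0)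
    (hτ : w * τ = w * derivative (derivative ((X - C ζ) ^ k * v)) +
      Q * derivative ((X - C ζ) ^ k * v) + R * ((X - C ζ) ^ k * v)) :
    ∃ j, k = j + (a + 2) ∧ ∃ τ', τ = (X - C ζ) ^ j * τ' ∧ τ'.eval ζ ≠ 0 := by
  have h1 := X_sub_C_mul_derivative_pow_mul ζ k v
  have h2 := X_sub_C_sq_mul_derivative_derivative_pow_mul ζ k v
  set t := X - C ζ with ht
  have htζ : t.eval ζ = 0 := by simp [ht]
  have ht0 : t ≠ 0 := X_sub_C_ne_zero ζ
  have hcop : ∀ {p : ℂ[X]}, p.eval ζ ≠ 0 → ∀ n, IsCoprime (t ^ n) p := fun {p} hp n =>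
    IsCoprime.pow_left ((irreducible_X_sub_C ζ).coprime_iff_not_dvd.2
      fun h => hp (dvd_iff_isRoot.1 h))
  obtain ⟨G, hG⟩ : ∃ G, G = (t ^ a * A') * (C ((k : ℂ) * (k - 1)) * v +
      2 * C (k : ℂ) * t * derivative v + t ^ 2 * derivative (derivative v)) +
      B * (C (k : ℂ) * v + t * derivative v) + D * v := ⟨_, rfl⟩
  have hGζ : G.eval ζ ≠ 0 := by
    have : G.eval ζ = ((t ^ a * A').eval ζ * ((k : ℂ) * (k - 1)) + B.eval ζ * k + D.eval ζ) *
        v.eval ζ := by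
      rw [hG]; simp [htζ]; ring
    rw [this]
    exact mul_ne_zero hk hv
  have hmain : t ^ (a + 2) * (A' * τ) = t ^ k * G := by
    apply mul_left_cancel₀ (pow_ne_zero s ht0)
    rw [hw] at hτ
    linear_combination t ^ 2 * hτ + t ^ s * (t ^ a * A') * h2 +
      (t * derivative (t ^ k * v)) * hQ + t ^ s * B * h1 + (t ^ k * v) * hR - t ^ s * t ^ k * hG
  have hle : a + 2 ≤ k := by
    have hd : t ^ (a + 2) ∣ t ^ k := (hcop hGζ _).dvd_of_dvd_mul_right ⟨_, hmain.symm⟩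
    have := natDegree_le_of_dvd hd (pow_ne_zero _ ht0)
    simpa [ht, natDegree_pow] using this
  obtain ⟨j, rfl⟩ := Nat.exists_eq_add_of_le' hle
  refine ⟨j, rfl, ?_⟩
  have hmain' : A' * τ = t ^ j * G := by
    apply mul_left_cancel₀ (pow_ne_zero (a + 2) ht0)
    rw [hmain]; ring
  obtain ⟨τ', rfl⟩ : t ^ j ∣ τ := (hcop hA' _).dvd_of_dvd_mul_left ⟨_, hmain'⟩
  refine ⟨τ', rfl, fun h0 => hGζ ?_⟩
  have : A' * τ' = G := by
    apply mul_left_cancel₀ (pow_ne_zero j ht0)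
    rw [← hmain']; ring
  rw [← this, eval_mul, h0, mul_zero]

theorem quadratic_eq_zero_of_three_roots {α β γ x y z : ℂ} (hxy : x ≠ y) (hxz : x ≠ z)
    (hyz : y ≠ z) (hx : α * (x * (x - 1)) + β * x + γ = 0)
    (hy : α * (y * (y - 1)) + β * y + γ = 0) (hz : α * (z * (z - 1)) + β * z + γ = 0) :
    α = 0 ∧ β = 0 ∧ γ = 0 := by
  have h1 : α * (x + y - 1) + β = 0 := by
    apply mul_left_cancel₀ (sub_ne_zero.2 hxy)
    linear_combination hx - hy
  have h2 : α * (x + z - 1) + β = 0 := by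
    apply mul_left_cancel₀ (sub_ne_zero.2 hxz)
    linear_combination hx - hz
  have hα : α = 0 := by
    apply mul_left_cancel₀ (sub_ne_zero.2 hyz)
    linear_combination h1 - h2
  subst hα
  have hβ : β = 0 := by linear_combination h1
  subst hβ
  exact ⟨rfl, rfl, by linear_combination hx⟩

/-- Let `T = d²/dX² + (Q/w) d/dX + R/w` map a space `U` of polynomials of finite codimension into
itself, and suppose that some element of `U` does not vanish at `ζ`. Then `ζ` is at most a regular
singular point with exponents `0` and `n + 1`, where `n` is even, and for every `ev` the equation
`T f = ev * f` has solutions to any finite order which do not vanish at `ζ`; that is, the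
Frobenius expansion starting at the exponent `0` is not obstructed at the exponent `n + 1`. -/
theorem exists_local_normal_form {w Q R : ℂ[X]} (hw0 : w ≠ 0) (U : Submodule ℂ ℂ[X])
    [Module.Finite ℂ (ℂ[X] ⧸ U)]
    (hT : ∀ y ∈ U, ∃ τ ∈ U, w * τ = w * derivative (derivative y) + Q * derivative y + R * y)
    {ζ : ℂ} (hζ : ∃ y ∈ U, y.eval ζ ≠ 0) :
    ∃ (s n : ℕ) (A B : ℂ[X]), w = (X - C ζ) ^ s * A ∧ (X - C ζ) * Q = (X - C ζ) ^ s * B ∧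
      A.eval ζ ≠ 0 ∧ B.eval ζ = -n * A.eval ζ ∧
      ∀ (ev : ℂ) (M : ℕ), ∃ f : ℂ[X], f.eval ζ ≠ 0 ∧
        w * (X - C ζ) ^ M ∣
          w * derivative (derivative f) + Q * derivative f + R * f - C ev * w * f := by
  obtain ⟨s, A, B, D, hw, hQ, hR, hABD⟩ := exists_euler_form w Q R hw0 ζ
  have hA0 : A ≠ 0 := by rintro rfl; exact hw0 (by simp [hw])
  obtain ⟨A', hA', hdvd⟩ := A.exists_eq_pow_rootMultiplicity_mul_and_not_dvd hA0 ζ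
  generalize A.rootMultiplicity ζ = a at hA'
  have hA'ζ : A'.eval ζ ≠ 0 := fun h => hdvd (dvd_iff_isRoot.2 h)
  obtain ⟨N, hN⟩ := exists_forall_ge_mem_vanishingOrders U ζ
  set I := vanishingOrders U ζ with hI
  obtain ⟨p, hp⟩ : ∃ p : ℕ → ℂ, ∀ k : ℕ, p k =
      A.eval ζ * ((k : ℂ) * (k - 1)) + B.eval ζ * k + D.eval ζ := ⟨_, fun _ => rfl⟩
  -- An order that is not a root of the indicial polynomial `p` drops by `a + 2` inside `I`.
  have hdrop : ∀ k ∈ I, p k ≠ 0 → ∃ j ∈ I, k = j + (a + 2) := by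
    rintro k ⟨v, hvU, hv⟩ hpk
    obtain ⟨τ, hτU, hτ⟩ := hT _ hvU
    rw [hp, hA'] at hpk
    obtain ⟨j, hj, τ', rfl, hτ'⟩ := order_drop (hA' ▸ hw) hQ hR hA'ζ hv hpk hτ
    exact ⟨j, ⟨τ', hτU, hτ'⟩, hj⟩
  have hroot : ∀ k ∈ I, ∃ k' ∈ I, p k' = 0 ∧ k' % (a + 2) = k % (a + 2) := by
    intro k
    induction k using Nat.strong_induction_on with
    | _ k ih =>
      intro hk
      by_cases hpk : p k = 0
      · exact ⟨k, hk, hpk, rfl⟩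
      obtain ⟨j, hjI, rfl⟩ := hdrop k hk hpk
      obtain ⟨k', hk', h0, hmod⟩ := ih j (by omega) hjI
      exact ⟨k', hk', h0, by rw [hmod, Nat.add_mod_right]⟩
  have hclass : ∀ i < a + 2, ∃ k ∈ I, p k = 0 ∧ k % (a + 2) = i := by
    intro i hi
    obtain ⟨k, hk, h0, hmod⟩ := hroot (i + (a + 2) * N)
      (hN _ (le_add_left (Nat.le_mul_of_pos_left N (by omega))))
    exact ⟨k, hk, h0, by rw [hmod, Nat.add_mul_mod_self_left, Nat.mod_eq_of_lt hi]⟩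
  -- A nonzero polynomial of degree two cannot have roots in three residue classes.
  have ha : a = 0 := by
    by_contra ha
    obtain ⟨k₀, -, hk₀, hm₀⟩ := hclass 0 (by omega)
    obtain ⟨k₁, -, hk₁, hm₁⟩ := hclass 1 (by omega)
    obtain ⟨k₂, -, hk₂, hm₂⟩ := hclass 2 (by omega)
    rw [hp] at hk₀ hk₁ hk₂
    refine hABD (quadratic_eq_zero_of_three_roots ?_ ?_ ?_ hk₀ hk₁ hk₂) <;>
      exact Nat.cast_injective.ne (by rintro rfl; omega)
  rw [ha] at hdrop hclass
  have hAζ : A.eval ζ ≠ 0 := by rw [hA', ha]; simpa using hA'ζ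
  have h0I : 0 ∈ I := by
    obtain ⟨y, hy, hyζ⟩ := hζ
    exact ⟨y, by simpa using hy, hyζ⟩
  have hD : D.eval ζ = 0 := by
    by_contra h
    obtain ⟨j, -, hj⟩ := hdrop 0 h0I (by simpa [hp] using h)
    omega
  obtain ⟨m, hmI, hm0, hmodd⟩ := hclass 1 (by omega)
  obtain ⟨n, rfl⟩ : ∃ n, m = n + 1 := ⟨m - 1, by omega⟩
  have hB : B.eval ζ = -n * A.eval ζ := by
    rw [hp, hD] at hm0
    push_cast at hm0
    apply mul_left_cancel₀ (Nat.cast_add_one_ne_zero n : (n : ℂ) + 1 ≠ 0)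
    linear_combination hm0
  have hpne : ∀ k : ℕ, k ≠ 0 → k ≠ n + 1 → p k ≠ 0 := by
    intro k hk0 hkn
    have : p k = A.eval ζ * (k * (k - ((n + 1 : ℕ) : ℂ))) := by
      rw [hp, hB, hD]; push_cast; ring
    rw [this]
    exact mul_ne_zero hAζ (mul_ne_zero (Nat.cast_ne_zero.2 hk0)
      (sub_ne_zero.2 (Nat.cast_injective.ne hkn)))
  have hdrop2 : ∀ k, k + 2 ∈ I → k + 2 ≠ n + 1 → k ∈ I := by
    intro k hk hkn
    obtain ⟨j, hj, hkj⟩ := hdrop (k + 2) hk (hpne _ (by omega) hkn)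
    rwa [show k = j by omega]
  -- An odd order below `n + 1` would descend past `0` without meeting a root.
  have hoddI : ∀ k ∈ I, k % 2 = 1 → n + 1 ≤ k := by
    intro k
    induction k using Nat.strong_induction_on with
    | _ k ih =>
      intro hk hkodd
      by_contra hlt
      obtain ⟨j, hj, hkj⟩ := hdrop k hk (hpne _ (by omega) (by omega))
      have := ih j (by omega) hj (by omega)
      omega
  -- Descending from a large order of the same parity passes through `k + 2`.
  have hup : ∀ k ∈ I, k + 2 ∈ I ∧ k + 2 ≠ n + 1 := by
    intro k hk
    have hne : ∀ i, k + 2 * i + 2 ≠ n + 1 := fun i hi => by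
      have := hoddI k hk (by omega)
      omega
    refine ⟨?_, hne 0⟩
    have hdesc : ∀ i, k + 2 * i + 2 ∈ I → k + 2 ∈ I := by
      intro i
      induction i with
      | zero => exact id
      | succ i ih => exact fun h => ih (hdrop2 _ h (hne (i + 1)))
    exact hdesc N (hN _ (by omega))
  refine ⟨s, n, A, B, hw, hQ, hAζ, hB, fun ev M => ?_⟩
  suffices H : ∃ f ∈ U, f.eval ζ ≠ 0 ∧ ∃ g ∈ U, (X - C ζ) ^ M ∣ g ∧
      w * derivative (derivative f) + Q * derivative f + R * f - C ev * w * f = w * g by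
    obtain ⟨f, -, hf, g, -, hg, hfg⟩ := H
    exact ⟨f, hf, hfg ▸ mul_dvd_mul_left w hg⟩
  induction M with
  | zero =>
    obtain ⟨y, hy, hyζ⟩ := hζ
    obtain ⟨τ, hτU, hτ⟩ := hT y hy
    refine ⟨y, hy, hyζ, τ - ev • y, U.sub_mem hτU (U.smul_mem _ hy), by simp, ?_⟩
    rw [← hτ, smul_eq_C_mul]; ring
  | succ M ih =>
    obtain ⟨f, hfU, hf, g, hgU, ⟨g', rfl⟩, hfg⟩ := ih
    by_cases hg' : g'.eval ζ = 0
    · refine ⟨f, hfU, hf, _, hgU, ?_, hfg⟩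
      rw [pow_succ]
      exact mul_dvd_mul_left _ (dvd_iff_isRoot.2 hg')
    -- The remainder has exact order `M`, so a multiple of an element of order `M + 2` corrects it.
    obtain ⟨⟨v, hvU, hv⟩, hMn⟩ := hup M ⟨g', hgU, hg'⟩
    obtain ⟨τ, hτU, hτ⟩ := hT _ hvU
    have hpk := hpne (M + 2) (by omega) hMn
    rw [hp, hA'] at hpk
    obtain ⟨j, hj, τ', rfl, hτ'⟩ := order_drop (hA' ▸ hw) hQ hR hA'ζ hv hpk hτ
    obtain rfl : M = j := by omega
    set h := (X - C ζ) ^ (M + 2) * v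
    set c := g'.eval ζ / τ'.eval ζ
    refine ⟨f - c • h, U.sub_mem hfU (U.smul_mem _ hvU), ?_,
      (X - C ζ) ^ M * g' - c • ((X - C ζ) ^ M * τ' - ev • h),
      U.sub_mem hgU (U.smul_mem _ (U.sub_mem hτU (U.smul_mem _ hvU))), ?_, ?_⟩
    · simpa [h] using hf
    · have : (X - C ζ) ^ M * g' - c • ((X - C ζ) ^ M * τ' - ev • h) =
          (X - C ζ) ^ M * (g' - C c * (τ' - C ev * (X - C ζ) ^ 2 * v)) := by
        simp only [smul_eq_C_mul, h]; ring
      rw [this, pow_succ]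
      refine mul_dvd_mul_left _ (dvd_iff_isRoot.2 ?_)
      simp [IsRoot, c, div_mul_cancel₀ _ hτ']
    · simp only [smul_eq_C_mul, derivative_sub, derivative_C_mul]
      linear_combination hfg + C c * hτ

end LocalAnalysis

/-! ### Removing the singular points -/

section Desingularization

open Polynomial

theorem dvd_of_forall_local {P G : ℂ[X]}
    (h : ∀ ζ, ∃ (N : ℕ) (E : ℂ[X]), P = (X - C ζ) ^ N * E ∧ E.eval ζ ≠ 0 ∧ (X - C ζ) ^ N ∣ G) :
    P ∣ G := by
  rcases eq_or_ne G 0 with rfl | hG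
  · exact dvd_zero _
  have hP : P ≠ 0 := by
    rintro rfl
    obtain ⟨N, E, hPE, hE, -⟩ := h 0
    rcases mul_eq_zero.1 hPE.symm with h | h
    · exact pow_ne_zero _ (X_sub_C_ne_zero _) h
    · exact hE (by simp [h])
  classical
  rw [IsAlgClosed.dvd_iff_roots_le_roots hP hG, Multiset.le_iff_count]
  intro ζ
  rw [count_roots, count_roots]
  obtain ⟨N, E, hPE, hE, hN⟩ := h ζ
  refine le_trans ?_ ((le_rootMultiplicity_iff hG).2 hN)
  rw [rootMultiplicity_le_iff hP, hPE, pow_succ,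
    mul_dvd_mul_iff_left (pow_ne_zero _ (X_sub_C_ne_zero _))]
  exact fun hd => hE (dvd_iff_isRoot.1 hd)

/-- In the notation of `exists_local_normal_form`, the function `w H' + Q H` vanishes at `ζ` to the
order of `w H` if `H` has order `n`. -/
theorem pow_dvd_of_residue {ζ : ℂ} {s n : ℕ} {w Q A B H E : ℂ[X]} (hw : w = (X - C ζ) ^ s * A)
    (hQ : (X - C ζ) * Q = (X - C ζ) ^ s * B) (hB : B.eval ζ = -n * A.eval ζ)
    (hH : H = (X - C ζ) ^ n * E) :
    (X - C ζ) ^ (s + n) ∣ w * derivative H + Q * H := by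
  obtain ⟨F, hF⟩ : X - C ζ ∣ C (n : ℂ) * A + B := dvd_iff_isRoot.2 (by simp [IsRoot, hB])
  have h1 := X_sub_C_mul_derivative_pow_mul ζ n E
  rw [← hH] at h1
  rw [← mul_dvd_mul_iff_left (X_sub_C_ne_zero ζ)]
  refine ⟨F * E + A * derivative E, ?_⟩
  rw [pow_add]
  linear_combination ((X - C ζ) * derivative H) * hw + (X - C ζ) ^ s * A * h1 +
    H * hQ + (X - C ζ) ^ s * B * hH + (X - C ζ) ^ s * (X - C ζ) ^ n * E * hF

/-- If `u` is the logarithmic derivative of an approximate solution `f` modulo `(X - C ζ) ^ n`, then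
it satisfies the Riccati equation to order `n`: the two leading terms of the error cancel because
the residue of `Q / w` at `ζ` is `-n`. -/
theorem pow_dvd_riccati {ζ ev : ℂ} {s n : ℕ} {w Q R A B f u : ℂ[X]} (hw : w = (X - C ζ) ^ s * A)
    (hQ : (X - C ζ) * Q = (X - C ζ) ^ s * B) (hB : B.eval ζ = -n * A.eval ζ)
    (hf : f.eval ζ ≠ 0) (hu : (X - C ζ) ^ n ∣ u * f - derivative f)
    (hfT : w * (X - C ζ) ^ n ∣
      w * derivative (derivative f) + Q * derivative f + R * f - C ev * w * f) :
    (X - C ζ) ^ (s + n) ∣ w * (derivative u + u ^ 2) + Q * u + R - C ev * w := by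
  obtain ⟨F, hF⟩ : X - C ζ ∣ C (n : ℂ) * A + B := dvd_iff_isRoot.2 (by simp [IsRoot, hB])
  obtain ⟨e, he⟩ := hu
  obtain ⟨d, hd⟩ := hfT
  have h1 := X_sub_C_mul_derivative_pow_mul ζ n e
  have he' := congrArg derivative he
  rw [derivative_sub, derivative_mul] at he'
  have hcop : IsCoprime ((X - C ζ) ^ (s + n)) (f ^ 2) :=
    IsCoprime.pow ((irreducible_X_sub_C ζ).coprime_iff_not_dvd.2
      fun h => hf (dvd_iff_isRoot.1 h))
  refine hcop.dvd_of_dvd_mul_left ?_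
  rw [← mul_dvd_mul_iff_left (X_sub_C_ne_zero ζ)]
  generalize derivative ((X - C ζ) ^ n * e) = D at h1 he'
  refine ⟨f * A * d + A * e * derivative f + A * (X - C ζ) ^ n * e ^ 2 + A * f * derivative e +
    F * f * e, ?_⟩
  generalize X - C ζ = t at *
  subst hw
  rw [pow_add]
  linear_combination t * f * t ^ s * A * he' - t * t ^ s * A * derivative f * he +
    t * t ^ s * A * (u * f + derivative f + t ^ n * e) * he + f ^ 2 * u * hQ + t ^ s * B * f * he -
    f * derivative f * hQ + t * f * hd + t ^ s * A * f * h1 + t ^ s * t ^ n * f * e * hF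

/-- With `H` and `u` as below, the substitution `y' = u y + H v` turns
`w y'' + Q y' + R y = ev w y` into the linear system `y' = u y + H v`, `v' = -δ y - (u + γ) v`,
whose coefficients are polynomials. Locally at `ζ`, the polynomial `H` has order `n`, and `u` agrees
to order `n` with the logarithmic derivative of a solution that does not vanish at `ζ`. -/
theorem exists_desingularization {w Q R : ℂ[X]} (hw0 : w ≠ 0)
    (hloc : ∀ ζ, ∃ (s n : ℕ) (A B : ℂ[X]), w = (X - C ζ) ^ s * A ∧
      (X - C ζ) * Q = (X - C ζ) ^ s * B ∧ A.eval ζ ≠ 0 ∧ B.eval ζ = -n * A.eval ζ ∧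
      ∀ (ev : ℂ) (M : ℕ), ∃ f : ℂ[X], f.eval ζ ≠ 0 ∧ w * (X - C ζ) ^ M ∣
        w * derivative (derivative f) + Q * derivative f + R * f - C ev * w * f) (ev : ℂ) :
    ∃ H u γ δ : ℂ[X], H ≠ 0 ∧ w * derivative H + Q * H = w * H * γ ∧
      w * (derivative u + u ^ 2) + Q * u + R - C ev * w = w * H * δ := by
  classical
  choose s n A B hw hQ hA hB hf using hloc
  choose f hfζ hfT using fun ζ => hf ζ ev (n ζ)
  set S := w.roots.toFinset with hS
  -- At an ordinary point `Q / w` has no residue, so the finite set `S` carries all of `n`.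
  have hnS : ∀ ζ ∉ S, n ζ = 0 := by
    intro ζ hζ
    have hwζ : w.eval ζ ≠ 0 := fun h => hζ (by simp [hS, hw0, h])
    have hs : s ζ = 0 := by
      by_contra h
      exact hwζ (by rw [hw ζ]; simp [h])
    have hB0 : (B ζ).eval ζ = 0 := by
      have := congrArg (eval ζ) (hQ ζ)
      rw [hs] at this
      simpa using this.symm
    have := hB ζ
    rw [hB0, eq_comm, mul_eq_zero] at this
    simpa [hA ζ] using this
  have hcopt : ∀ {x y : ℂ}, x ≠ y → IsCoprime (X - C x) (X - C y) := fun h =>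
    isCoprime_X_sub_C_of_isUnit_sub (sub_ne_zero.2 h).isUnit
  set H := ∏ ζ ∈ S, (X - C ζ) ^ n ζ with hH
  have hHζ : ∀ ζ, ∃ E : ℂ[X], H = (X - C ζ) ^ n ζ * E ∧ E.eval ζ ≠ 0 := by
    intro ζ
    refine ⟨∏ x ∈ S.erase ζ, (X - C x) ^ n x, ?_, ?_⟩
    · by_cases hζ : ζ ∈ S
      · rw [hH, Finset.mul_prod_erase S (fun x => (X - C x) ^ n x) hζ]
      · rw [hnS ζ hζ, pow_zero, one_mul, Finset.erase_eq_of_notMem hζ]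
    · rw [eval_prod]
      refine Finset.prod_ne_zero_iff.2 fun x hx => ?_
      rw [eval_pow, eval_sub, eval_X, eval_C]
      exact pow_ne_zero _ (sub_ne_zero.2 (Finset.ne_of_mem_erase hx).symm)
  have hH0 : H ≠ 0 := Finset.prod_ne_zero_iff.2 fun x _ => pow_ne_zero _ (X_sub_C_ne_zero x)
  -- The Chinese remainder theorem provides `u`.
  have hu : ∃ u : ℂ[X], ∀ ζ, (X - C ζ) ^ n ζ ∣ u * f ζ - derivative (f ζ) := by
    have hinv : ∀ ζ, ∃ g : ℂ[X], (X - C ζ) ^ n ζ ∣ g * f ζ - 1 := by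
      intro ζ
      have hcop : IsCoprime ((X - C ζ) ^ n ζ) (f ζ) :=
        IsCoprime.pow_left ((irreducible_X_sub_C ζ).coprime_iff_not_dvd.2
          fun h => hfζ ζ (dvd_iff_isRoot.1 h))
      obtain ⟨b, g, hbg⟩ := hcop
      exact ⟨g, -b, by linear_combination hbg⟩
    choose g hg using hinv
    have hpair : Pairwise (Function.onFun IsCoprime
        fun ζ : S => Ideal.span {(X - C (ζ : ℂ)) ^ n ζ}) := by
      intro x y hxy
      rw [Function.onFun, Ideal.isCoprime_span_singleton_iff]
      exact IsCoprime.pow (hcopt fun h => hxy (Subtype.ext h))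
    obtain ⟨u, hu⟩ := Ideal.exists_forall_sub_mem_ideal hpair
      fun ζ : S => g ζ * derivative (f ζ)
    refine ⟨u, fun ζ => ?_⟩
    by_cases hζ : ζ ∈ S
    · have h1 := Ideal.mem_span_singleton.1 (hu ⟨ζ, hζ⟩)
      have h2 := (h1.mul_right (f ζ)).add ((hg ζ).mul_right (derivative (f ζ)))
      convert h2 using 1
      ring
    · simp [hnS ζ hζ]
  obtain ⟨u, hu⟩ := hu
  have hdvd : ∀ G : ℂ[X], (∀ ζ, (X - C ζ) ^ (s ζ + n ζ) ∣ G) → w * H ∣ G := by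
    refine fun G hG => dvd_of_forall_local fun ζ => ?_
    obtain ⟨E, hE, hEζ⟩ := hHζ ζ
    refine ⟨s ζ + n ζ, A ζ * E, ?_, by simpa using ⟨hA ζ, hEζ⟩, hG ζ⟩
    rw [hE, pow_add]
    linear_combination ((X - C ζ) ^ n ζ * E) * hw ζ
  obtain ⟨γ, hγ⟩ := hdvd (w * derivative H + Q * H) fun ζ => by
    obtain ⟨E, hE, -⟩ := hHζ ζ
    exact pow_dvd_of_residue (hw ζ) (hQ ζ) (hB ζ) hE
  obtain ⟨δ, hδ⟩ := hdvd (w * (derivative u + u ^ 2) + Q * u + R - C ev * w) fun ζ =>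
    pow_dvd_riccati (hw ζ) (hQ ζ) (hB ζ) (hfζ ζ) (hu ζ) (hfT ζ)
  exact ⟨H, u, γ, δ, hH0, hγ, hδ⟩

end Desingularization

/-! ### Solutions of the cleared equation -/

section Solutions

open Polynomial

/-- Near `z`, except possibly at `z`, the function `f` satisfies `w f'' + Q f' + R f = ev w f`. -/
def SolvesClearedNear (w Q R : ℂ[X]) (ev : ℂ) (f : ℂ → ℂ) (z : ℂ) : Prop :=
  ∀ᶠ x in 𝓝[≠] z, w.eval x * deriv (deriv f) x + Q.eval x * deriv f x + R.eval x * f x =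
    ev * w.eval x * f x

theorem eventually_eval_ne_zero {w : ℂ[X]} (hw : w ≠ 0) (z : ℂ) :
    ∀ᶠ x in 𝓝[≠] z, w.eval x ≠ 0 := by
  have h : ∀ᶠ x in 𝓝[≠] z, x ∉ (w.roots.toFinset.erase z : Finset ℂ) :=
    nhdsWithin_le_nhds ((Finset.isClosed _).isOpen_compl.mem_nhds (by simp))
  filter_upwards [h, self_mem_nhdsWithin] with x hx hxz h0
  exact hx (by simp [hw, h0, show x ≠ z from hxz])

theorem deriv_eval (y : ℂ[X]) : deriv (fun z => y.eval z) = fun z => (derivative y).eval z :=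
  funext fun _ => y.deriv

theorem eventually_deriv_add_const_mul {f g : ℂ → ℂ} {z : ℂ} (hf : AnalyticAt ℂ f z)
    (hg : AnalyticAt ℂ g z) (c : ℂ) :
    deriv (fun y => f y + c * g y) =ᶠ[𝓝 z] fun x => deriv f x + c * deriv g x := by
  filter_upwards [hf.eventually_analyticAt, hg.eventually_analyticAt] with x hfx hgx
  rw [deriv_fun_add hfx.differentiableAt (hgx.differentiableAt.const_mul c),
    deriv_const_mul c hgx.differentiableAt]

theorem SolvesClearedNear.add_const_mul {w Q R : ℂ[X]} {ev z : ℂ} {f g : ℂ → ℂ}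
    (hf : SolvesClearedNear w Q R ev f z) (hg : SolvesClearedNear w Q R ev g z)
    (hfa : AnalyticAt ℂ f z) (hga : AnalyticAt ℂ g z) (c : ℂ) :
    SolvesClearedNear w Q R ev (fun y => f y + c * g y) z := by
  have h1 := eventually_deriv_add_const_mul hfa hga c
  have h2 := h1.deriv.trans (eventually_deriv_add_const_mul hfa.deriv hga.deriv c)
  filter_upwards [hf, hg, nhdsWithin_le_nhds h1, nhdsWithin_le_nhds h2] with x hf hg h1 h2
  rw [h1, h2]
  linear_combination hf + c * hg

/-- If `f` vanished to finite order `k ≥ 2` at the ordinary point `z`, then `w f''` would have order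
`k - 2` and the other terms order at least `k - 1`. -/
theorem SolvesClearedNear.eventually_eq_zero {w Q R : ℂ[X]} {ev z : ℂ} {f : ℂ → ℂ}
    (hf : SolvesClearedNear w Q R ev f z) (hfa : AnalyticAt ℂ f z) (hw : w.eval z ≠ 0)
    (h0 : f z = 0) (h1 : deriv f z = 0) : ∀ᶠ x in 𝓝 z, f x = 0 := by
  have hpoly : ∀ p : ℂ[X], AnalyticAt ℂ (fun x => p.eval x) z := fun p =>
    p.differentiable.analyticAt z
  rw [← analyticOrderAt_eq_top]
  have e1 := hfa.analyticOrderAt_deriv_add_one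
  have e2 := hfa.deriv.analyticOrderAt_deriv_add_one
  simp only [h0, h1, sub_zero] at e1 e2
  have heq : (fun x => w.eval x) * deriv (deriv f) =ᶠ[𝓝 z]
      (fun x => (C ev * w - R).eval x) * f + (fun x => (-Q).eval x) * deriv f := by
    refine (AnalyticAt.frequently_eq_iff_eventually_eq ((hpoly _).mul hfa.deriv.deriv)
      (((hpoly _).mul hfa).add ((hpoly _).mul hfa.deriv))).1 (Eventually.frequently ?_)
    filter_upwards [hf] with x hx
    simp only [Pi.mul_apply, Pi.add_apply, eval_sub, eval_mul, eval_C, eval_neg]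
    linear_combination hx
  have h3 := analyticOrderAt_congr heq
  rw [analyticOrderAt_mul (hpoly _) hfa.deriv.deriv,
    (hpoly w).analyticOrderAt_eq_zero.2 hw, zero_add] at h3
  have h4 := le_analyticOrderAt_add (f := (fun x => (C ev * w - R).eval x) * f)
    (g := (fun x => (-Q).eval x) * deriv f) (z₀ := z)
  rw [← h3, analyticOrderAt_mul (hpoly _) hfa, analyticOrderAt_mul (hpoly _) hfa.deriv] at h4
  have h5 : analyticOrderAt (deriv f) z ≤ analyticOrderAt (deriv (deriv f)) z := by
    refine le_trans (le_min ?_ le_add_self) h4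
    exact le_trans (e1 ▸ le_self_add) le_add_self
  rw [← e2] at h5
  have htop : analyticOrderAt (deriv (deriv f)) z = ⊤ := by
    by_contra h
    lift analyticOrderAt (deriv (deriv f)) z to ℕ using h with k
    have : k + 1 ≤ k := by exact_mod_cast h5
    omega
  rw [← e1, ← e2, htop]
  rfl

/-- The two solutions of the desingularized system with initial values `(1, 0)` and `(0, 1)` at `0`
give two entire solutions of the original equation. -/
theorem exists_entire_solutions {w Q R H u γ δ : ℂ[X]} {ev : ℂ} (hH : H ≠ 0)
    (hγ : w * derivative H + Q * H = w * H * γ)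
    (hδ : w * (derivative u + u ^ 2) + Q * u + R - C ev * w = w * H * δ) :
    ∃ φ₁ φ₂ : ℂ → ℂ, Differentiable ℂ φ₁ ∧ Differentiable ℂ φ₂ ∧
      (∀ z, SolvesClearedNear w Q R ev φ₁ z) ∧ (∀ z, SolvesClearedNear w Q R ev φ₂ z) ∧
      LinearIndependent ℂ ![φ₁, φ₂] := by
  have hsolve : ∀ y v : ℂ → ℂ, (∀ z, HasDerivAt y (u.eval z * y z + H.eval z * v z) z) →
      (∀ z, HasDerivAt v ((-δ).eval z * y z + (-(u + γ)).eval z * v z) z) →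
      ∀ z, SolvesClearedNear w Q R ev y z := by
    intro y v hy hv z
    refine Eventually.of_forall fun x => ?_
    have hy' : deriv y = fun z => u.eval z * y z + H.eval z * v z := funext fun z => (hy z).deriv
    have hy'' := (((u.hasDerivAt x).mul (hy x)).add ((H.hasDerivAt x).mul (hv x))).deriv
    have hy3 : deriv (deriv y) x =
        deriv ((fun x => u.eval x) * y + (fun x => H.eval x) * v) x := by rw [hy']; rfl
    have hγ' := congrArg (eval x) hγ
    have hδ' := congrArg (eval x) hδ
    simp only [eval_add, eval_mul, eval_sub, eval_pow, eval_C] at hγ' hδ'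
    rw [hy3, hy'', hy']
    simp only [eval_neg, eval_add]
    linear_combination (v x) * hγ' + (y x) * hδ'
  obtain ⟨y₁, v₁, hy₁0, -, hy₁, hv₁⟩ := exists_entire_solution_system u H (-δ) (-(u + γ)) 1 0
  obtain ⟨y₂, v₂, hy₂0, hv₂0, hy₂, hv₂⟩ := exists_entire_solution_system u H (-δ) (-(u + γ)) 0 1
  refine ⟨y₁, y₂, fun z => (hy₁ z).differentiableAt, fun z => (hy₂ z).differentiableAt,
    hsolve y₁ v₁ hy₁ hv₁, hsolve y₂ v₂ hy₂ hv₂, ?_⟩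
  rw [LinearIndependent.pair_iff]
  intro a b hab
  have ha : a = 0 := by simpa [hy₁0, hy₂0] using congrFun hab 0
  refine ⟨ha, by_contra fun hb => ?_⟩
  have hy₂z : y₂ = 0 := by simpa [ha, hb] using hab
  -- If `y₂ = 0`, then `H * v₂ = 0`, whereas `v₂ 0 = 1`.
  have hHv : ∀ z, H.eval z * v₂ z = 0 := fun z => by
    have := (hy₂ z).deriv
    simpa [hy₂z] using this.symm
  have hne : ∀ᶠ z in 𝓝[≠] (0 : ℂ), v₂ z ≠ 0 :=
    nhdsWithin_le_nhds ((hv₂ 0).continuousAt.eventually_ne (by simp [hv₂0]))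
  obtain ⟨z, hz1, hz2⟩ := (hne.and (eventually_eval_ne_zero hH 0)).exists
  exact mul_ne_zero hz2 hz1 (hHv z)

/-- Two linearly independent entire solutions span the holomorphic solutions on any domain. -/
theorem exists_eq_combination {w Q R : ℂ[X]} (hw : w ≠ 0) {ev : ℂ} {φ₁ φ₂ : ℂ → ℂ}
    (hφ₁ : Differentiable ℂ φ₁) (hφ₂ : Differentiable ℂ φ₂)
    (h₁ : ∀ z, SolvesClearedNear w Q R ev φ₁ z) (h₂ : ∀ z, SolvesClearedNear w Q R ev φ₂ z)
    (hli : LinearIndependent ℂ ![φ₁, φ₂]) {U : Set ℂ} {f : ℂ → ℂ} (hU : IsOpen U)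
    (hUc : IsConnected U) (hf : DifferentiableOn ℂ f U)
    (hfs : ∀ z ∈ U, SolvesClearedNear w Q R ev f z) :
    ∃ c₁ c₂ : ℂ, ∀ z ∈ U, f z = c₁ * φ₁ z + c₂ * φ₂ z := by
  obtain ⟨z₁, hz₁⟩ := hUc.nonempty
  obtain ⟨z₀, hz₀U, hz₀⟩ := ((eventually_nhdsWithin_of_eventually_nhds
    (hU.eventually_mem hz₁)).and (eventually_eval_ne_zero hw z₁)).exists
  have a₁ : ∀ z, AnalyticAt ℂ φ₁ z := fun z => hφ₁.analyticAt z
  have a₂ : ∀ z, AnalyticAt ℂ φ₂ z := fun z => hφ₂.analyticAt z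
  have hzero : ∀ z, SolvesClearedNear w Q R ev (fun _ => (0 : ℂ)) z := fun z =>
    Eventually.of_forall fun x => by simp
  have hcomb : ∀ (g : ℂ → ℂ) (c₁ c₂ : ℂ), AnalyticAt ℂ g z₀ → SolvesClearedNear w Q R ev g z₀ →
      g z₀ + c₁ * φ₁ z₀ + c₂ * φ₂ z₀ = 0 →
      deriv g z₀ + c₁ * deriv φ₁ z₀ + c₂ * deriv φ₂ z₀ = 0 →
      ∀ᶠ x in 𝓝 z₀, g x + c₁ * φ₁ x + c₂ * φ₂ x = 0 := by
    intro g c₁ c₂ hg hgs e0 e1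
    have hg1 : AnalyticAt ℂ (fun x => g x + c₁ * φ₁ x) z₀ :=
      hg.add (analyticAt_const.mul (a₁ z₀))
    have s1 := hgs.add_const_mul (h₁ z₀) hg (a₁ z₀) c₁
    refine (s1.add_const_mul (h₂ z₀) hg1 (a₂ z₀) c₂).eventually_eq_zero
      (hg1.add (analyticAt_const.mul (a₂ z₀))) hz₀ e0 ?_
    rw [(eventually_deriv_add_const_mul hg1 (a₂ z₀) c₂).eq_of_nhds,
      (eventually_deriv_add_const_mul hg (a₁ z₀) c₁).eq_of_nhds, e1]
  -- The initial values at `z₀` determine a combination, because a combination with zero initial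
  -- values vanishes near `z₀`, hence everywhere.
  let L : (ℂ × ℂ) →ₗ[ℂ] ℂ × ℂ :=
    { toFun := fun c => (c.1 * φ₁ z₀ + c.2 * φ₂ z₀, c.1 * deriv φ₁ z₀ + c.2 * deriv φ₂ z₀)
      map_add' := fun c d => by ext <;> simp <;> ring
      map_smul' := fun a c => by ext <;> simp <;> ring }
  have hL : Function.Injective L := by
    rw [← LinearMap.ker_eq_bot, LinearMap.ker_eq_bot']
    rintro ⟨c₁, c₂⟩ hc
    obtain ⟨e0, e1⟩ := Prod.mk.inj hc
    have hev := hcomb (fun _ => 0) c₁ c₂ analyticAt_const (hzero z₀) (by simpa using e0)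
      (by simpa using e1)
    have hz : (fun x => c₁ * φ₁ x + c₂ * φ₂ x) = fun _ => 0 := by
      refine AnalyticOnNhd.eq_of_eventuallyEq (z₀ := z₀)
        (fun z _ => (analyticAt_const.mul (a₁ z)).add (analyticAt_const.mul (a₂ z)))
        (fun z _ => analyticAt_const) ?_
      filter_upwards [hev] with x hx
      simpa using hx
    obtain ⟨rfl, rfl⟩ := LinearIndependent.pair_iff.1 hli c₁ c₂ hz
    rfl
  obtain ⟨⟨c₁, c₂⟩, hc⟩ := (LinearMap.injective_iff_surjective.1 hL) (f z₀, deriv f z₀)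
  obtain ⟨e0, e1⟩ := Prod.mk.inj hc
  refine ⟨c₁, c₂, ?_⟩
  have hfa : AnalyticOnNhd ℂ f U := hf.analyticOnNhd hU
  refine hfa.eqOn_of_preconnected_of_eventuallyEq
    (g := fun z => c₁ * φ₁ z + c₂ * φ₂ z)
    (fun z _ => (analyticAt_const.mul (a₁ z)).add (analyticAt_const.mul (a₂ z)))
    hUc.isPreconnected hz₀U ?_
  filter_upwards [hcomb f (-c₁) (-c₂) (hfa z₀ hz₀U) (hfs z₀ hz₀U)
    (by linear_combination -e0) (by linear_combination -e1)] with x hx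
  linear_combination hx

end Solutions

/-! ### Rationality of the coefficients -/

section Rationality

open Polynomial

theorem finite_quotient_of_natDegrees (U : Submodule ℂ ℂ[X]) (N : ℕ)
    (h : ∀ n ≥ N, ∃ y ∈ U, y ≠ 0 ∧ y.natDegree = n) : Module.Finite ℂ (ℂ[X] ⧸ U) := by
  have key : ∀ (n : ℕ) (p : ℂ[X]), p.degree < n → ∃ r ∈ degreeLT ℂ N, p - r ∈ U := by
    intro n
    induction n with
    | zero =>
      intro p hp
      have : p = 0 := by
        by_contra h0
        rw [degree_eq_natDegree h0] at hp
        exact Nat.not_lt_zero _ (by exact_mod_cast hp)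
      exact ⟨0, Submodule.zero_mem _, by simp [this]⟩
    | succ n ih =>
      intro p hp
      by_cases hn : n < N
      · refine ⟨p, mem_degreeLT.2 (hp.trans_le ?_), by simp⟩
        exact_mod_cast hn
      obtain ⟨y, hyU, hy0, rfl⟩ := h n (not_lt.1 hn)
      set c := p.coeff y.natDegree / y.leadingCoeff
      obtain ⟨r, hr, hrU⟩ := ih (p - c • y) (by
        rw [degree_lt_iff_coeff_zero] at hp ⊢
        intro m hm
        rcases hm.eq_or_lt with rfl | hlt
        · simp [c, hy0]
        · simp [hp m hlt, coeff_eq_zero_of_natDegree_lt hlt])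
      refine ⟨r, hr, ?_⟩
      have := U.add_mem hrU (U.smul_mem c hyU)
      convert this using 1
      ring
  refine Module.Finite.of_surjective (U.mkQ.comp (degreeLT ℂ N).subtype) fun x => ?_
  obtain ⟨p, rfl⟩ := U.mkQ_surjective x
  obtain ⟨r, hr, hrU⟩ := key (p.natDegree + 1) p
    (degree_le_natDegree.trans_lt (by exact_mod_cast Nat.lt_succ_self _))
  refine ⟨⟨r, hr⟩, ?_⟩
  rw [LinearMap.comp_apply, Submodule.subtype_apply, ← sub_eq_zero, ← map_sub,
    Submodule.mkQ_apply, Submodule.Quotient.mk_eq_zero, ← neg_sub]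
  exact U.neg_mem hrU

theorem wronskian_ne_zero_of_natDegree_lt {y₁ y₂ : ℂ[X]} (h₁ : y₁ ≠ 0) (h₂ : y₂ ≠ 0)
    (h : y₁.natDegree < y₂.natDegree) : wronskian y₁ y₂ ≠ 0 := by
  intro hW
  have hX : ∀ y : ℂ[X], (X * derivative y).natDegree ≤ y.natDegree ∧
      (X * derivative y).coeff y.natDegree = y.natDegree * y.leadingCoeff := by
    intro y
    have hc : ∀ m, (X * derivative y).coeff m = m * y.coeff m := by
      rintro (_ | m)
      · simp
      · rw [coeff_X_mul, coeff_derivative]; push_cast; ring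
    refine ⟨natDegree_le_iff_coeff_eq_zero.2 fun m hm => ?_, hc _⟩
    rw [hc, coeff_eq_zero_of_natDegree_lt hm, mul_zero]
  have e : y₁ * (X * derivative y₂) - X * derivative y₁ * y₂ = 0 := by
    rw [wronskian] at hW
    linear_combination X * hW
  have h3 := congrArg (fun p => coeff p (y₁.natDegree + y₂.natDegree)) e
  simp only [coeff_sub, coeff_zero] at h3
  rw [coeff_mul_add_eq_of_natDegree_le le_rfl (hX y₂).1,
    coeff_mul_add_eq_of_natDegree_le (hX y₁).1 le_rfl, (hX y₁).2, (hX y₂).2] at h3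
  have h4 : ((y₂.natDegree : ℂ) - y₁.natDegree) * (y₁.leadingCoeff * y₂.leadingCoeff) = 0 := by
    rw [leadingCoeff, leadingCoeff] at *
    linear_combination h3
  refine mul_ne_zero (sub_ne_zero.2 (Nat.cast_injective.ne h.ne')) (mul_ne_zero ?_ ?_) h4 <;>
    simpa using ‹_›

/-- Cramer's rule, applied to the eigenvalue equations of two eigenpolynomials, shows that `q` and
`r` are rational functions. -/
theorem exists_rational_coefficients {q r : ℂ → ℂ} {y₁ y₂ : ℂ[X]}
    (h₁ : IsPolyEigenfunction q r y₁) (h₂ : IsPolyEigenfunction q r y₂)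
    (h : y₁.natDegree < y₂.natDegree) :
    ∃ w Q R : ℂ[X], w ≠ 0 ∧ (∀ z, ∀ᶠ x in 𝓝[≠] z, w.eval x * q x = Q.eval x) ∧
      ∀ z, ∀ᶠ x in 𝓝[≠] z, w.eval x * r x = R.eval x := by
  obtain ⟨hy₁, ev₁, hs₁⟩ := h₁
  obtain ⟨hy₂, ev₂, hs₂⟩ := h₂
  set g₁ := C (ev₁ : ℂ) * y₁ - derivative (derivative y₁)
  set g₂ := C (ev₂ : ℂ) * y₂ - derivative (derivative y₂)
  refine ⟨wronskian y₁ y₂, y₁ * g₂ - y₂ * g₁, g₁ * derivative y₂ - g₂ * derivative y₁,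
    wronskian_ne_zero_of_natDegree_lt hy₁ hy₂ h, fun z => ?_, fun z => ?_⟩ <;>
  · filter_upwards [hs₁ z (Set.mem_univ z), hs₂ z (Set.mem_univ z)] with x e₁ e₂
    simp only [diffOp, deriv_eval] at e₁ e₂
    simp only [wronskian, g₁, g₂, eval_sub, eval_mul, eval_C]
    first
    | linear_combination y₁.eval x * e₂ - y₂.eval x * e₁
    | linear_combination (derivative y₂).eval x * e₁ - (derivative y₁).eval x * e₂

theorem solvesNear_iff_cleared {q r : ℂ → ℂ} {w Q R : ℂ[X]} (hw : w ≠ 0) {z : ℂ}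
    (hQ : ∀ᶠ x in 𝓝[≠] z, w.eval x * q x = Q.eval x)
    (hR : ∀ᶠ x in 𝓝[≠] z, w.eval x * r x = R.eval x) (ev : ℂ) (f : ℂ → ℂ) :
    SolvesNear q r ev f z ↔ SolvesClearedNear w Q R ev f z := by
  refine eventually_congr ?_
  filter_upwards [hQ, hR, eventually_eval_ne_zero hw z] with x hQ hR hwx
  rw [diffOp, ← hQ, ← hR, ← mul_right_inj' hwx]
  constructor <;> intro h <;> linear_combination h

/-- For a polynomial the cleared equation is an identity of polynomials. -/
theorem SolvesClearedNear.polynomial_identity {w Q R y : ℂ[X]} {ev z : ℂ}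
    (h : SolvesClearedNear w Q R ev (fun x => y.eval x) z) :
    w * derivative (derivative y) + Q * derivative y + R * y = C ev * w * y := by
  refine eq_of_infinite_eval_eq _ _ ?_
  refine Set.Infinite.mono (s := {x | w.eval x * deriv (deriv fun x => y.eval x) x +
    Q.eval x * deriv (fun x => y.eval x) x + R.eval x * y.eval x =
      ev * w.eval x * y.eval x}) (fun x hx => ?_) 
    fun hfin => infinite_of_mem_nhds z (insert_mem_nhds_iff.2 h) (hfin.insert z)
  simpa [deriv_eval] using hx

theorem generalSolutionEntire_of_isPrimitiveOp {q r : ℂ → ℂ}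
    (hsolv : SolvableByPolynomials q r) (hprim : IsPrimitiveOp q r) (ev : ℂ) :
    GeneralSolutionEntire q r ev := by
  obtain ⟨N₀, hN₀⟩ := hsolv.bddAbove
  have hN : ∀ n ≥ N₀ + 1, ∃ y : ℂ[X], IsPolyEigenfunction q r y ∧ y.natDegree = n := by
    intro n hn
    by_contra h
    have : n ≤ N₀ := hN₀ h
    omega
  obtain ⟨y₁, hy₁, hd₁⟩ := hN (N₀ + 1) le_rfl
  obtain ⟨y₂, hy₂, hd₂⟩ := hN (N₀ + 2) (by omega)
  obtain ⟨w, Q, R, hw, hQ, hR⟩ := exists_rational_coefficients hy₁ hy₂ (by omega)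
  have hiff := fun z => solvesNear_iff_cleared hw (hQ z) (hR z)
  set U := Submodule.span ℂ {y : ℂ[X] | IsPolyEigenfunction q r y}
  have hfin : Module.Finite ℂ (ℂ[X] ⧸ U) := by
    refine finite_quotient_of_natDegrees U (N₀ + 1) fun n hn => ?_
    obtain ⟨y, hy, hyn⟩ := hN n hn
    exact ⟨y, Submodule.subset_span hy, hy.1, hyn⟩
  have hT : ∀ y ∈ U, ∃ τ ∈ U,
      w * τ = w * derivative (derivative y) + Q * derivative y + R * y := by
    intro y hy
    induction hy using Submodule.span_induction with
    | mem y hy =>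
      obtain ⟨-, lam, hlam⟩ := id hy
      have h := ((hiff 0 lam _).1 (hlam 0 (Set.mem_univ 0))).polynomial_identity
      refine ⟨(lam : ℂ) • y, U.smul_mem _ (Submodule.subset_span hy), ?_⟩
      rw [h, smul_eq_C_mul]
      ring
    | zero => exact ⟨0, U.zero_mem, by simp⟩
    | add x y _ _ hx hy =>
      obtain ⟨a, ha, ha'⟩ := hx
      obtain ⟨b, hb, hb'⟩ := hy
      refine ⟨a + b, U.add_mem ha hb, ?_⟩
      simp only [derivative_add]
      linear_combination ha' + hb'
    | smul c x _ hx =>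
      obtain ⟨a, ha, ha'⟩ := hx
      refine ⟨c • a, U.smul_mem c ha, ?_⟩
      simp only [smul_eq_C_mul, derivative_C_mul]
      linear_combination C c * ha'
  have hζ : ∀ ζ, ∃ y ∈ U, y.eval ζ ≠ 0 := by
    intro ζ
    by_contra! h
    refine hprim ⟨X - C ζ, by simp, fun y hy => dvd_iff_isRoot.2 (h y (Submodule.subset_span hy))⟩
  obtain ⟨H, u, γ, δ, hH, hγ, hδ⟩ := exists_desingularization hw
    (fun ζ => exists_local_normal_form hw U hT (hζ ζ)) ev
  obtain ⟨φ₁, φ₂, hφ₁, hφ₂, h₁, h₂, hli⟩ := exists_entire_solutions hH hγ hδ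
  refine ⟨φ₁, φ₂, hφ₁, hφ₂, fun z _ => (hiff z ev φ₁).2 (h₁ z), fun z _ => (hiff z ev φ₂).2 (h₂ z),
    hli, fun V f hV hVc hf hfs => ?_⟩
  exact exists_eq_combination hw hφ₁ hφ₂ h₁ h₂ hli hV hVc hf fun z hz =>
    (hiff z ev f).1 (hfs z hz)

/-- Entire solutions whose germs are dependent at one point are dependent, by the identity
theorem. -/
theorem trivialMonodromy_of_generalSolutionEntire {q r : ℂ → ℂ}
    (h : ∀ ev, GeneralSolutionEntire q r ev) : TrivialMonodromy q r := by
  intro ζ ev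
  obtain ⟨φ₁, φ₂, hφ₁, hφ₂, h₁, h₂, hli, -⟩ := h ev
  refine ⟨φ₁, φ₂, (hφ₁.analyticAt ζ).meromorphicAt, (hφ₂.analyticAt ζ).meromorphicAt,
    h₁ ζ (Set.mem_univ ζ), h₂ ζ (Set.mem_univ ζ), fun c₁ c₂ hc => ?_⟩
  refine LinearIndependent.pair_iff.1 hli c₁ c₂ ?_
  refine AnalyticOnNhd.eq_of_frequently_eq (z₀ := ζ)
    (fun z _ => (analyticAt_const.mul (hφ₁.analyticAt z)).add
      (analyticAt_const.mul (hφ₂.analyticAt z)))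
    (fun z _ => analyticAt_const) (Eventually.frequently ?_)
  filter_upwards [hc] with x hx
  simpa using hx

end Rationality

theorem mainTheorem3 (q r : ℂ → ℂ)
    (hq : Meromorphic q) (hr : Meromorphic r)
    (hsolv : SolvableByPolynomials q r) (hprim : IsPrimitiveOp q r) :
    (∀ ev : ℂ, GeneralSolutionEntire q r ev) ∧ TrivialMonodromy q r := by
  have h := fun ev => generalSolutionEntire_of_isPrimitiveOp hsolv hprim ev
  exact ⟨h, trivialMonodromy_of_generalSolutionEntire h⟩
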